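/- Let $d \in \mathbb{N}$. Write $\langle\cdot,\cdot\rangle$ for the standard scalar product of $\mathbb{R}^d$, and for $L, X \subseteq \mathbb{R}^d$ put $R_L(X) := \operatorname{conv}(X \setminus \operatorname{int} L)$. A rational polyhedron is the solution set in $\mathbb{R}^d$ of a finite system of linear inequalities with rational coefficients and right-hand sides. For a $d$-dimensional rational polyhedron $L$ in $\mathbb{R}^d$ define $m(L)$ (the max-facet-width of $L$) as follows: if $L \neq \mathbb{R}^d$ and the recession cone of $L$ is a linear space, then $m(L)$ is the minimal positive integer $m$ such that $$L = \{x \in \mathbb{R}^d : b_i - m \le \langle a_i, x\rangle \le b_i \text{ for all } i = 1,\dots,n\}$$ for some positive integer $n$, some $a_1,\dots,a_n \in \mathbb{Z}^d \setminus \{0\}$ and some $b_1,\dots,b_n \in \mathbb{Z}$; if $L = \mathbb{R}^d$ or the recession cone of $L$ is not a linear space, then $m(L) := +\infty$. For a family $\mathcal{L}$ of $d$-dimensional rational polyhedra in $\mathbb{R}^d$ put $m(\mathcal{L}) := \sup_{L \in \mathcal{L}} m(L)$, where the supremum over the empty family is $0$. Theorem. Let $P$ be a rational polyhedron in $\mathbb{R}^d$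 and let $\mathcal{L}$ be a family of $d$-dimensional rational polyhedra in $\mathbb{R}^d$ satisfying $m(\mathcal{L}) < +\infty$. Then there exists a finite subfamily $\mathcal{L}'$ of $\mathcal{L}$ such that for every $L \in \mathcal{L}$ there is some $L' \in \mathcal{L}'$ with $R_{L'}(P) \subseteq R_L(P)$. -/

import Mathlib

/-!
The space `ℝ^d` is modelled by `Fin d → ℝ` with the standard scalar product `⬝ᵥ`.
No norm is used; the topology of `Fin d → ℝ` is the usual topology of `ℝ^d`.
-/

/-- A rational polyhedron in `ℝ^d`: the solution set of a finite system of linear inequalities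
with rational coefficients (the whole space and the empty set are included). -/
def IsRationalPolyhedron {d : ℕ} (P : Set (Fin d → ℝ)) : Prop :=
  ∃ (n : ℕ) (a : Fin n → Fin d → ℚ) (b : Fin n → ℚ),
    P = {x : Fin d → ℝ | ∀ i, (fun j => (a i j : ℝ)) ⬝ᵥ x ≤ (b i : ℝ)}

/-- A set in `ℝ^d` is `d`-dimensional if its affine hull is all of `ℝ^d`. -/
def IsFullDimensional {d : ℕ} (L : Set (Fin d → ℝ)) : Prop :=
  affineSpan ℝ L = ⊤

/-- The recession cone of a set `L`. -/
def recCone {d : ℕ} (L : Set (Fin d → ℝ)) : Set (Fin d → ℝ) :=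
  {u | ∀ x ∈ L, ∀ t : ℝ, 0 ≤ t → x + t • u ∈ L}

/-- A set is a linear space if it is a linear subspace of `ℝ^d`. -/
def IsLinearSpace {d : ℕ} (C : Set (Fin d → ℝ)) : Prop :=
  ∃ W : Submodule ℝ (Fin d → ℝ), (W : Set (Fin d → ℝ)) = C

/-- `L` can be given as `{x | b_i - m ≤ ⟨a_i, x⟩ ≤ b_i for i = 1, …, n}` with a positive integer
`n`, nonzero integral vectors `a_i` and integers `b_i`. -/
def HasFacetWidthRep {d : ℕ} (L : Set (Fin d → ℝ)) (m : ℕ) : Prop :=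
  ∃ (n : ℕ) (a : Fin n → Fin d → ℤ) (b : Fin n → ℤ), 0 < n ∧ (∀ i, a i ≠ 0) ∧
    L = {x : Fin d → ℝ | ∀ i, (b i : ℝ) - (m : ℝ) ≤ (fun j => (a i j : ℝ)) ⬝ᵥ x ∧
      (fun j => (a i j : ℝ)) ⬝ᵥ x ≤ (b i : ℝ)}

open Classical in
/-- The max-facet-width `m(L)`: if `L ≠ ℝ^d` and the recession cone of `L` is a linear space, the
minimal positive integer `m` for which `L` has a representation as above; otherwise `∞`. -/
noncomputable def maxFacetWidth {d : ℕ} (L : Set (Fin d → ℝ)) : ℕ∞ :=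
  if L ≠ Set.univ ∧ IsLinearSpace (recCone L) then
    ⨅ (m : ℕ) (_ : 0 < m ∧ HasFacetWidthRep L m), (m : ℕ∞)
  else ⊤

/-- The max-facet-width of a family: the supremum of the max-facet-widths of its members. -/
noncomputable def familyMaxFacetWidth {d : ℕ} (𝓛 : Set (Set (Fin d → ℝ))) : ℕ∞ :=
  ⨆ L ∈ 𝓛, maxFacetWidth L

/-- The functional `R_L(X) = conv (X \ int L)`. -/
def cutHull {d : ℕ} (L X : Set (Fin d → ℝ)) : Set (Fin d → ℝ) :=
  convexHull ℝ (X \ interior L)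

/-! The cone over `P` is generated by finitely many integral vectors `G`: scaled points of `P` and,
at height `0`, rays. Cutting a finitely generated cone by a half-space `α ≥ 0` leaves a cone
generated by the old generators in the half-space and the points where segments or rays between
generators cross `α = 0`. So `R_L(P)` is governed by two kinds of data: which generators lie outside
`int L`, and, for `g` inside, when `g + t • k` leaves `int L`. If `L'` has no more generators
outside than `L`, and every exit from `L'` happens no earlier, then `R_{L'}(P) ⊆ R_L(P)`
(`cutHull_subset`).

The reciprocal exit time is the maximum of `α(k)⁺ / (-α(g))` over the facet forms `α`. The width
bound confines the positive integer `-α(g)` to at most `N * g.2` (`neg_intForm_le`), so the factor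
`(N * g.2)!` clears all denominators, uniformly in `L`. Each `L` thus yields a vector of natural
numbers of fixed length, and by Dickson's lemma finitely many minimal vectors lie below all others.
-/

/-! ### Half-space sections of generated cones, and homogenization -/

/-- If `K` contains every generator on which `f` is nonnegative, and every positive combination of
generators `g`, `h` on opposite sides of the hyperplane `f = 0` that lies on this hyperplane,
then `K` contains the part of the generated cone on which `f` is nonnegative. -/
theorem PointedCone.mem_of_mem_hull_of_nonneg {E : Type*} [AddCommGroup E] [Module ℝ E]
    (S : Set E) (f : E →ₗ[ℝ] ℝ) (K : PointedCone ℝ E)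
    (hpos : ∀ g ∈ S, 0 ≤ f g → g ∈ K)
    (hpair : ∀ g ∈ S, ∀ h ∈ S, f g < 0 → 0 < f h → f h • g - f g • h ∈ K)
    {z : E} (hz : z ∈ PointedCone.hull ℝ S) (hfz : 0 ≤ f z) : z ∈ K := by
  set A := PointedCone.hull ℝ {g | g ∈ S ∧ 0 ≤ f g} with hA
  set B := PointedCone.hull ℝ {g | g ∈ S ∧ f g < 0} with hB
  have hzAB : z ∈ A ⊔ B := by
    refine (Submodule.span_le (p := A ⊔ B)).2 (fun g hg => ?_) hz
    rcases le_or_gt 0 (f g) with h | h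
    · exact Submodule.mem_sup_left (Submodule.subset_span ⟨hg, h⟩)
    · exact Submodule.mem_sup_right (Submodule.subset_span ⟨hg, h⟩)
  have hAK : A ≤ K := Submodule.span_le.2 fun g hg => hpos g hg.1 hg.2
  have hfA : ∀ p ∈ A, 0 ≤ f p := by
    intro p hp
    induction hp using Submodule.span_induction with
    | mem x hx => exact hx.2
    | zero => simp
    | add x y _ _ hx hy => rw [map_add]; exact add_nonneg hx hy
    | smul c x _ hx =>
      rw [show c • x = (c : ℝ) • x from rfl, map_smul, smul_eq_mul]
      exact mul_nonneg c.2 hx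
  have hfB : ∀ q ∈ B, f q < 0 ∨ q = 0 := by
    intro q hq
    induction hq using Submodule.span_induction with
    | mem x hx => exact Or.inl hx.2
    | zero => exact Or.inr rfl
    | add x y _ _ hx hy =>
      rw [map_add]
      rcases hx with hx | rfl
      · rcases hy with hy | rfl
        · exact Or.inl (add_neg hx hy)
        · simpa using Or.inl hx
      · simpa using hy
    | smul c x _ hx =>
      rw [show c • x = (c : ℝ) • x from rfl, map_smul, smul_eq_mul]
      rcases hx with hx | rfl
      · rcases eq_or_lt_of_le c.2 with hc | hc
        · right; rw [← hc, zero_smul]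
        · exact Or.inl (mul_neg_of_pos_of_neg hc hx)
      · simp
  have hAB : ∀ p ∈ A, ∀ q ∈ B, f p • q - f q • p ∈ K := by
    intro p hp q hq
    induction hp using Submodule.span_induction with
    | mem g hg =>
      induction hq using Submodule.span_induction with
      | mem h hh =>
        rcases eq_or_lt_of_le hg.2 with h0 | h0
        · rw [← h0, zero_smul, zero_sub, ← neg_smul]
          exact K.smul_mem (by linarith [hh.2]) (hpos g hg.1 hg.2)
        · exact hpair h hh.1 g hg.1 hh.2 h0
      | zero => simp
      | add x y _ _ hx hy =>
        have := K.add_mem hx hy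
        convert this using 1
        rw [map_add]; module
      | smul c x _ hx =>
        rw [show c • x = (c : ℝ) • x from rfl]
        have := Submodule.smul_mem K c hx
        rw [show c • (f g • x - f x • g) = (c : ℝ) • (f g • x - f x • g) from rfl] at this
        convert this using 1
        rw [map_smul, smul_eq_mul]; module
    | zero => simp
    | add x y _ _ hx hy =>
      have := K.add_mem hx hy
      convert this using 1
      rw [map_add]; module
    | smul c x _ hx =>
      rw [show c • x = (c : ℝ) • x from rfl]
      have := Submodule.smul_mem K c hx
      rw [show c • (f x • q - f q • x) = (c : ℝ) • (f x • q - f q • x) from rfl] at this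
      convert this using 1
      rw [map_smul, smul_eq_mul]; module
  obtain ⟨p, hp, q, hq, rfl⟩ := Submodule.mem_sup.1 hzAB
  -- For `f q < 0`, `p + q` is the sum of `(f p)⁻¹ • (f p • q - f q • p)` and `(1 + f q / f p) • p`,
  -- whose coefficient is nonnegative because `f (p + q) ≥ 0`.
  rcases hfB q hq with h | rfl
  · rw [map_add] at hfz
    have hfp : 0 < f p := by linarith
    have h1 := K.smul_mem (inv_nonneg.2 hfp.le) (hAB p hp q hq)
    have h2 : (1 + f q / f p) • p ∈ K := by
      refine K.smul_mem ?_ (hAK hp)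
      have : 1 + f q / f p = (f p + f q) / f p := by field_simp
      rw [this]; positivity
    convert K.add_mem h1 h2 using 1
    rw [smul_sub, smul_smul, smul_smul, inv_mul_cancel₀ hfp.ne', add_smul, div_eq_inv_mul]
    module
  · simpa using hAK hp

/-- The cone over a convex set `C`, closed by the recession directions of `C` at height `0`. -/
def homogenization {d : ℕ} (C : Set (Fin d → ℝ)) (hC : Convex ℝ C) :
    PointedCone ℝ ((Fin d → ℝ) × ℝ) where
  carrier := {z | (0 < z.2 ∧ z.2⁻¹ • z.1 ∈ C) ∨ (z.2 = 0 ∧ z.1 ∈ recCone C)}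
  zero_mem' := Or.inr ⟨rfl, fun x hx t _ => by simpa using hx⟩
  add_mem' := by
    have key : ∀ p q : Fin d → ℝ, ∀ s : ℝ, 0 < s → s⁻¹ • p ∈ C → q ∈ recCone C →
        s⁻¹ • (p + q) ∈ C := fun p q s hs hp hq => by
      rw [smul_add]; exact hq _ hp _ (inv_nonneg.2 hs.le)
    rintro ⟨p, s⟩ ⟨q, t⟩ (⟨hs, hp⟩ | ⟨hs, hp⟩) (⟨ht, hq⟩ | ⟨ht, hq⟩)
    · left
      dsimp only [Prod.fst_add, Prod.snd_add, Prod.mk_add_mk] at *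
      have hst : 0 < s + t := add_pos hs ht
      refine ⟨hst, ?_⟩
      have := hC hp hq (a := s / (s + t)) (b := t / (s + t)) (by positivity) (by positivity)
        (by field_simp)
      convert this using 1
      rw [smul_smul, smul_smul, smul_add]
      congr 2 <;> field_simp
    · left
      dsimp only [Prod.mk_add_mk] at *
      subst ht
      rw [add_zero]
      exact ⟨hs, key p q s hs hp hq⟩
    · left
      dsimp only [Prod.mk_add_mk] at *
      subst hs
      rw [zero_add, add_comm p q]
      exact ⟨ht, key q p t ht hq hp⟩
    · right
      dsimp only [Prod.mk_add_mk] at *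
      refine ⟨by rw [hs, ht, add_zero], fun x hx r hr => ?_⟩
      rw [smul_add, ← add_assoc]
      exact hq _ (hp _ hx r hr) r hr
  smul_mem' := by
    rintro ⟨c, hc⟩ ⟨p, s⟩ h
    change (0 < c * s ∧ (c * s)⁻¹ • c • p ∈ C) ∨ (c * s = 0 ∧ c • p ∈ recCone C)
    rcases eq_or_lt_of_le hc with rfl | hc
    · right
      refine ⟨zero_mul s, fun x hx t _ => by simpa using hx⟩
    · rcases h with ⟨hs, hp⟩ | ⟨hs, hp⟩
      · left
        dsimp only at hs hp
        refine ⟨mul_pos hc hs, ?_⟩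
        rw [smul_smul]
        convert hp using 2
        field_simp
      · right
        dsimp only at hs hp
        refine ⟨by rw [hs, mul_zero], fun x hx t ht => ?_⟩
        rw [smul_smul]
        exact hp x hx _ (mul_nonneg ht hc.le)

theorem mem_homogenization {d : ℕ} {C : Set (Fin d → ℝ)} {hC : Convex ℝ C}
    {z : (Fin d → ℝ) × ℝ} : z ∈ homogenization C hC ↔
      (0 < z.2 ∧ z.2⁻¹ • z.1 ∈ C) ∨ (z.2 = 0 ∧ z.1 ∈ recCone C) :=
  Iff.rfl

theorem mk_one_mem_homogenization {d : ℕ} {C : Set (Fin d → ℝ)} {hC : Convex ℝ C}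
    {x : Fin d → ℝ} : (x, (1 : ℝ)) ∈ homogenization C hC ↔ x ∈ C := by
  simp [mem_homogenization]

/-! ### Integral generators of rational polyhedra -/

/-- The inclusion of integral vectors into the homogenized space `ℝ^d × ℝ`. -/
def intVec {d : ℕ} (g : (Fin d → ℤ) × ℤ) : (Fin d → ℝ) × ℝ :=
  (fun j => (g.1 j : ℝ), (g.2 : ℝ))

/-- The homogenization of the affine function `x ↦ ⟨a, x⟩ - b`, for `α = (a, b)`. -/
def affineForm {d : ℕ} (α : (Fin d → ℤ) × ℤ) : (Fin d → ℝ) × ℝ →ₗ[ℝ] ℝ where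
  toFun z := (fun j => (α.1 j : ℝ)) ⬝ᵥ z.1 - (α.2 : ℝ) * z.2
  map_add' x y := by simp only [Prod.fst_add, Prod.snd_add, dotProduct_add]; ring
  map_smul' c x := by
    simp only [Prod.smul_fst, Prod.smul_snd, dotProduct_smul, smul_eq_mul, RingHom.id_apply]; ring

theorem affineForm_apply {d : ℕ} (α : (Fin d → ℤ) × ℤ) (z : (Fin d → ℝ) × ℝ) :
    affineForm α z = (fun j => (α.1 j : ℝ)) ⬝ᵥ z.1 - (α.2 : ℝ) * z.2 := rfl

/-- The value of `affineForm α` at an integral vector. -/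
def intForm {d : ℕ} (α g : (Fin d → ℤ) × ℤ) : ℤ := α.1 ⬝ᵥ g.1 - α.2 * g.2

theorem affineForm_intVec {d : ℕ} (α g : (Fin d → ℤ) × ℤ) :
    affineForm α (intVec g) = (intForm α g : ℝ) := by
  simp [affineForm_apply, intForm, intVec, dotProduct]

theorem intVec_smul_sub_smul {d : ℕ} (m n : ℤ) (g h : (Fin d → ℤ) × ℤ) :
    intVec (m • g - n • h) = (m : ℝ) • intVec g - (n : ℝ) • intVec h := by
  ext <;> simp [intVec]

/-- Base case of the double description method: no inequalities at all. -/
theorem hull_intVec_pm_unit_eq_top (d : ℕ) : ∃ G : Set ((Fin d → ℤ) × ℤ), G.Finite ∧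
    PointedCone.hull ℝ (intVec '' G) = ⊤ := by
  let E : Set ((Fin d → ℤ) × ℤ) := insert (0, 1) (Set.range fun i => (Pi.single i 1, 0))
  have hE : E.Finite := (Set.finite_range _).insert _
  refine ⟨E ∪ (Neg.neg '' E), hE.union (hE.image _), ?_⟩
  set K := PointedCone.hull ℝ (intVec '' (E ∪ (Neg.neg '' E))) with hK
  have hunit : ∀ e ∈ E, ∀ c : ℝ, c • intVec e ∈ K := by
    intro e he c
    rcases le_total 0 c with hc | hc
    · exact K.smul_mem hc (Submodule.subset_span ⟨e, Or.inl he, rfl⟩)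
    · have h1 : intVec (-e) ∈ K := Submodule.subset_span ⟨-e, Or.inr ⟨e, he, rfl⟩, rfl⟩
      have := K.smul_mem (neg_nonneg.2 hc) h1
      convert this using 1
      ext <;> simp [intVec]
  refine eq_top_iff.2 fun z _ => ?_
  have hz : z = z.2 • intVec (0, 1) + ∑ i, z.1 i • intVec (Pi.single i 1, 0) := by
    ext j
    · simp [intVec, Prod.fst_sum, Finset.sum_apply, Pi.single_apply]
    · simp [intVec, Prod.snd_sum]
  rw [hz]
  exact K.add_mem (hunit _ (Set.mem_insert _ _) _)
    (K.sum_mem fun i _ => hunit _ (Set.mem_insert_of_mem _ ⟨i, rfl⟩) _)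

/-- The double description method: a cone cut out by finitely many integral inequalities is
generated by finitely many integral vectors. -/
theorem exists_finite_generators {d : ℕ} (A : Finset ((Fin d → ℤ) × ℤ)) :
    ∃ G : Set ((Fin d → ℤ) × ℤ), G.Finite ∧
      ∀ z, z ∈ PointedCone.hull ℝ (intVec '' G) ↔ ∀ α ∈ A, 0 ≤ affineForm α z := by
  classical
  induction A using Finset.induction_on with
  | empty =>
    obtain ⟨G, hG, h⟩ := hull_intVec_pm_unit_eq_top d
    exact ⟨G, hG, fun z => by simp [h]⟩
  | insert α A _ ih =>
    obtain ⟨G, hG, h⟩ := ih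
    let G₁ : Set ((Fin d → ℤ) × ℤ) := {g | g ∈ G ∧ 0 ≤ intForm α g}
    let G₂ : Set ((Fin d → ℤ) × ℤ) := (fun q : ((Fin d → ℤ) × ℤ) × ((Fin d → ℤ) × ℤ) =>
      intForm α q.2 • q.1 - intForm α q.1 • q.2) ''
        {q | q ∈ G ×ˢ G ∧ intForm α q.1 < 0 ∧ 0 < intForm α q.2}
    refine ⟨G₁ ∪ G₂, (hG.subset fun g hg => hg.1).union
      (((hG.prod hG).subset fun q hq => hq.1).image _), fun z => ⟨fun hz => ?_, fun hz => ?_⟩⟩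
    · have hgen : ∀ g ∈ G, ∀ β ∈ A, 0 ≤ affineForm β (intVec g) := fun g hg =>
        (h _).1 (Submodule.subset_span ⟨g, hg, rfl⟩)
      induction hz using Submodule.span_induction with
      | mem x hx =>
        obtain ⟨_, ⟨hg, hα⟩ | ⟨⟨g, k⟩, ⟨⟨hg, hk⟩, hgα, hkα⟩, rfl⟩, rfl⟩ := hx
        · intro β hβ
          rcases Finset.mem_insert.1 hβ with rfl | hβ
          · rw [affineForm_intVec]; exact_mod_cast hα
          · exact hgen _ hg β hβ
        · intro β hβ
          dsimp only at *
          rw [intVec_smul_sub_smul, map_sub, map_smul, map_smul, smul_eq_mul, smul_eq_mul]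
          rcases Finset.mem_insert.1 hβ with rfl | hβ
          · rw [affineForm_intVec, affineForm_intVec]; linarith
          · have h1 := hgen g hg β hβ
            have h2 := hgen k hk β hβ
            have h3 : (intForm α g : ℝ) ≤ 0 := by exact_mod_cast hgα.le
            have h4 : (0 : ℝ) ≤ intForm α k := by exact_mod_cast hkα.le
            nlinarith [mul_nonneg h4 h1, mul_nonneg (neg_nonneg.2 h3) h2]
      | zero => intro β _; simp
      | add x y _ _ hx hy =>
        intro β hβ; rw [map_add]; exact add_nonneg (hx β hβ) (hy β hβ)
      | smul c x _ hx =>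
        intro β hβ
        rw [show c • x = (c : ℝ) • x from rfl, map_smul, smul_eq_mul]
        exact mul_nonneg c.2 (hx β hβ)
    · refine PointedCone.mem_of_mem_hull_of_nonneg (intVec '' G) (affineForm α) _ ?_ ?_
        ((h z).2 fun β hβ => hz β (Finset.mem_insert_of_mem hβ)) (hz α (Finset.mem_insert_self _ _))
      · rintro _ ⟨g, hg, rfl⟩ hα
        rw [affineForm_intVec] at hα
        exact Submodule.subset_span ⟨g, Or.inl ⟨hg, by exact_mod_cast hα⟩, rfl⟩
      · rintro _ ⟨g, hg, rfl⟩ _ ⟨k, hk, rfl⟩ hgα hkα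
        rw [affineForm_intVec] at hgα hkα
        rw [affineForm_intVec, affineForm_intVec, ← intVec_smul_sub_smul]
        exact Submodule.subset_span ⟨_, Or.inr ⟨(g, k), ⟨⟨hg, hk⟩, by exact_mod_cast hgα,
          by exact_mod_cast hkα⟩, rfl⟩, rfl⟩

theorem exists_pos_mul_eq_intCast {ι : Type*} [Fintype ι] (v : ι → ℚ) :
    ∃ D : ℕ, 0 < D ∧ ∃ w : ι → ℤ, ∀ i, (w i : ℚ) = D * v i := by
  refine ⟨∏ i, (v i).den, Finset.prod_pos fun i _ => (v i).den_pos,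
    fun i => ((∏ j, (v j).den) / (v i).den : ℕ) * (v i).num, fun i => ?_⟩
  have hdvd : (v i).den ∣ ∏ j, (v j).den := Finset.dvd_prod_of_mem _ (Finset.mem_univ i)
  have hne : ((v i).den : ℚ) ≠ 0 := by exact_mod_cast (v i).den_nz
  rw [Int.cast_mul, Int.cast_natCast, Nat.cast_div hdvd hne]
  nth_rewrite 3 [← Rat.num_div_den (v i)]
  field_simp

/-- The cone over a rational polyhedron is generated by finitely many integral vectors. -/
theorem IsRationalPolyhedron.exists_generators {d : ℕ} {P : Set (Fin d → ℝ)}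
    (hP : IsRationalPolyhedron P) : ∃ G : Set ((Fin d → ℤ) × ℤ), G.Finite ∧
      (∀ z ∈ PointedCone.hull ℝ (intVec '' G), 0 ≤ z.2) ∧
      ∀ x, x ∈ P ↔ (x, (1 : ℝ)) ∈ PointedCone.hull ℝ (intVec '' G) := by
  classical
  obtain ⟨n, a, b, rfl⟩ := hP
  have hclear : ∀ i, ∃ D : ℕ, 0 < D ∧ ∃ α : (Fin d → ℤ) × ℤ,
      (∀ j, (α.1 j : ℝ) = -(D * (a i j : ℝ))) ∧ (α.2 : ℝ) = -(D * (b i : ℝ)) := by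
    intro i
    -- Indexing by `Option` clears the coefficients and the right-hand side with one common
    -- denominator.
    obtain ⟨D, hD, w, hw⟩ := exists_pos_mul_eq_intCast (fun o : Option (Fin d) => o.elim (b i) (a i))
    refine ⟨D, hD, (fun j => -w (some j), -w none), fun j => ?_, ?_⟩
    · have := hw (some j)
      simp only [Option.elim] at this
      push_cast
      rw [neg_inj]
      exact_mod_cast congrArg (fun q : ℚ => (q : ℝ)) this
    · have := hw none
      simp only [Option.elim] at this
      push_cast
      rw [neg_inj]
      exact_mod_cast congrArg (fun q : ℚ => (q : ℝ)) this
  choose D hD α hα₁ hα₂ using hclear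
  -- The form of `(0, -1)` is the height `z.2`; including it keeps the cone in the upper half-space.
  obtain ⟨G, hG, h⟩ := exists_finite_generators (insert (0, -1) (Finset.univ.image α))
  refine ⟨G, hG, fun z hz => ?_, fun x => ?_⟩
  · have := (h z).1 hz (0, -1) (Finset.mem_insert_self _ _)
    simpa [affineForm_apply, dotProduct] using this
  · rw [h]
    have hval : ∀ i, affineForm (α i) (x, 1) =
        D i * ((b i : ℝ) - (fun j => (a i j : ℝ)) ⬝ᵥ x) := by
      intro i
      rw [affineForm_apply, hα₂, mul_sub]
      have : (fun j => ((α i).1 j : ℝ)) = (-(D i : ℝ)) • fun j => (a i j : ℝ) := by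
        ext j; simp [hα₁]
      rw [this, smul_dotProduct, smul_eq_mul]; ring
    have hpos : ∀ i, (0 : ℝ) < D i := fun i => by exact_mod_cast hD i
    simp only [Finset.forall_mem_insert, Finset.forall_mem_image, Finset.mem_univ, true_implies,
      hval, Set.mem_ofPred_eq]
    constructor
    · refine fun hx => ⟨by simp [affineForm_apply, dotProduct], fun i => ?_⟩
      exact mul_nonneg (hpos i).le (sub_nonneg.2 (hx i))
    · rintro ⟨-, hx⟩ i
      exact sub_nonneg.1 (nonneg_of_mul_nonneg_right (@hx i) (hpos i))

/-! ### Facet systems -/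

/-- A finite system of strict integral inequalities that describes the interior of `L` and bounds
the width of `L` in the direction of each inequality by `N`. -/
structure IsFacetSystem {d : ℕ} (F : Finset ((Fin d → ℤ) × ℤ)) (N : ℕ)
    (L : Set (Fin d → ℝ)) : Prop where
  mem_interior_iff : ∀ x, x ∈ interior L ↔ ∀ α ∈ F, affineForm α (x, 1) < 0
  exists_opposite : ∀ α ∈ F, ∃ b : ℤ, (-α.1, b) ∈ F ∧ α.2 + b ≤ N

/-- A short move from `x` in direction `c` stays in `L` and strictly increases `c ⬝ᵥ x`. -/
theorem dotProduct_lt_of_mem_interior {d : ℕ} {L : Set (Fin d → ℝ)} {c : Fin d → ℝ} {β : ℝ}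
    (hc : c ≠ 0) (hL : ∀ x ∈ L, c ⬝ᵥ x ≤ β) {x : Fin d → ℝ} (hx : x ∈ interior L) :
    c ⬝ᵥ x < β := by
  have hcont : Continuous fun t : ℝ => x + t • c := by fun_prop
  have hnhds : (fun t : ℝ => x + t • c) ⁻¹' interior L ∈ nhds (0 : ℝ) :=
    (isOpen_interior.preimage hcont).mem_nhds (by simpa using hx)
  obtain ⟨ε, hε, hball⟩ := Metric.mem_nhds_iff.1 hnhds
  have hmem : x + (ε / 2) • c ∈ interior L := by
    apply hball
    rw [Metric.mem_ball, Real.dist_eq, sub_zero, abs_of_pos (by positivity)]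
    linarith
  have h1 := hL _ (interior_subset hmem)
  rw [dotProduct_add, dotProduct_smul, smul_eq_mul] at h1
  have h2 : 0 < c ⬝ᵥ c := by
    refine lt_of_le_of_ne (Finset.sum_nonneg fun i _ => mul_self_nonneg (c i)) fun h => hc ?_
    exact dotProduct_self_eq_zero.1 h.symm
  have h3 : 0 < ε / 2 * (c ⬝ᵥ c) := by positivity
  linarith

theorem HasFacetWidthRep.exists_isFacetSystem {d : ℕ} {L : Set (Fin d → ℝ)} {m N : ℕ}
    (h : HasFacetWidthRep L m) (hmN : m ≤ N) : ∃ F, IsFacetSystem F N L := by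
  classical
  obtain ⟨n, a, b, -, ha, rfl⟩ := h
  set L := {x : Fin d → ℝ | ∀ i, (b i : ℝ) - (m : ℝ) ≤ (fun j => (a i j : ℝ)) ⬝ᵥ x ∧
      (fun j => (a i j : ℝ)) ⬝ᵥ x ≤ (b i : ℝ)} with hL
  let F : Finset ((Fin d → ℤ) × ℤ) := Finset.univ.image (fun i => (a i, b i)) ∪
    Finset.univ.image (fun i => (-a i, m - b i))
  have hcast : ∀ i, (fun j => (((-a i) j : ℤ) : ℝ)) = -fun j => (a i j : ℝ) := by
    intro i; ext j; simp
  have hne : ∀ i, (fun j => (a i j : ℝ)) ≠ 0 := by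
    intro i h0
    refine ha i (funext fun j => ?_)
    simpa using congrFun h0 j
  have hF : ∀ x : Fin d → ℝ, (∀ α ∈ F, affineForm α (x, 1) < 0) ↔
      ∀ i, (b i : ℝ) - (m : ℝ) < (fun j => (a i j : ℝ)) ⬝ᵥ x ∧
        (fun j => (a i j : ℝ)) ⬝ᵥ x < (b i : ℝ) := by
    intro x
    simp only [F, Finset.forall_mem_union, Finset.forall_mem_image, Finset.mem_univ, true_implies,
      affineForm_apply, hcast, neg_dotProduct, mul_one]
    push_cast
    exact ⟨fun h i => ⟨by linarith [h.2 (x := i)], by linarith [h.1 (x := i)]⟩,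
      fun h => ⟨fun i => by linarith [(h i).2], fun i => by linarith [(h i).1]⟩⟩
  refine ⟨F, fun x => ⟨fun hx => (hF x).2 fun i => ⟨?_, ?_⟩, fun hx => ?_⟩, fun α hα => ?_⟩
  · have := dotProduct_lt_of_mem_interior (c := -fun j => (a i j : ℝ)) (β := (m : ℝ) - b i)
      (neg_ne_zero.2 (hne i)) (fun y hy => by rw [neg_dotProduct]; linarith [(hy i).1]) hx
    rw [neg_dotProduct] at this
    linarith
  · exact dotProduct_lt_of_mem_interior (hne i) (fun y hy => (hy i).2) hx
  · have hopen : IsOpen {y : Fin d → ℝ | ∀ α ∈ F, affineForm α (y, 1) < 0} := by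
      have : {y : Fin d → ℝ | ∀ α ∈ F, affineForm α (y, 1) < 0} =
          ⋂ α ∈ F, {y : Fin d → ℝ | affineForm α (y, 1) < 0} := by
        ext; simp
      rw [this]
      refine isOpen_biInter_finset fun α _ => isOpen_lt ?_ continuous_const
      simp only [affineForm_apply, dotProduct]
      fun_prop
    refine interior_maximal (fun y hy i => ?_) hopen hx
    have := (hF y).1 hy i
    exact ⟨this.1.le, this.2.le⟩
  · simp only [F, Finset.mem_union, Finset.mem_image, Finset.mem_univ, true_and] at hα ⊢
    rcases hα with ⟨i, rfl⟩ | ⟨i, rfl⟩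
    · exact ⟨m - b i, Or.inr ⟨i, rfl⟩, by dsimp only; omega⟩
    · exact ⟨b i, Or.inl ⟨i, by rw [neg_neg]⟩, by dsimp only; omega⟩

/-! ### Comparison of cut hulls -/

namespace IsFacetSystem

variable {d N : ℕ} {L : Set (Fin d → ℝ)} {F : Finset ((Fin d → ℤ) × ℤ)}

theorem notMem_interior_iff (h : IsFacetSystem F N L) {x : Fin d → ℝ} :
    x ∉ interior L ↔ ∃ α ∈ F, 0 ≤ affineForm α (x, 1) := by
  rw [h.mem_interior_iff]; push Not; rfl

/-- Let `y ∈ P` violate the strict inequality of `α`. If `α` does not decrease along `u`, the whole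
ray from `y` stays outside `int L`. Otherwise the opposite form increases, so the ray is outside
again far enough out, and convexity fills the gap. -/
theorem recCone_subset (h : IsFacetSystem F N L) (P : Set (Fin d → ℝ)) :
    recCone P ⊆ recCone (cutHull L P) := by
  intro u hu y hy t ht
  have hconv : Convex ℝ (cutHull L P) := convex_convexHull ℝ _
  have hmem : ∀ z ∈ P, (∃ α ∈ F, 0 ≤ affineForm α (z, 1)) → z ∈ cutHull L P := fun z hz hα =>
    subset_convexHull ℝ _ ⟨hz, h.notMem_interior_iff.2 hα⟩
  have hline : ∀ (α : (Fin d → ℤ) × ℤ) (y : Fin d → ℝ) (s : ℝ),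
      affineForm α (y + s • u, 1) = affineForm α (y, 1) + s * affineForm α (u, 0) := by
    intro α y s
    rw [← smul_eq_mul, ← map_smul, ← map_add]
    simp
  refine convexHull_min (t := {y | y + t • u ∈ cutHull L P}) ?_
    (hconv.translate_preimage_left (t • u)) hy
  rintro y ⟨hyP, hyL⟩
  obtain ⟨α, hα, hαy⟩ := h.notMem_interior_iff.1 hyL
  rcases le_or_gt 0 (affineForm α (u, 0)) with hαu | hαu
  · exact hmem _ (hu y hyP t ht) ⟨α, hα, by rw [hline]; positivity⟩
  · obtain ⟨b, hb, -⟩ := h.exists_opposite α hα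
    set β : (Fin d → ℤ) × ℤ := (-α.1, b)
    have hβu : 0 < affineForm β (u, 0) := by
      have : affineForm β (u, 0) = -affineForm α (u, 0) := by
        simp [affineForm_apply, β, dotProduct]
      linarith
    rcases eq_or_lt_of_le ht with rfl | ht
    · simpa using hmem y hyP ⟨α, hα, hαy⟩
    -- Beyond both `t` and the zero of `β` along the ray.
    set s := max t (-affineForm β (y, 1) / affineForm β (u, 0))
    have hts : t ≤ s := le_max_left _ _
    have hs : 0 < s := ht.trans_le hts
    have hend : y + s • u ∈ cutHull L P := by
      refine hmem _ (hu y hyP s hs.le) ⟨β, hb, ?_⟩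
      have := (div_le_iff₀ hβu).1 (le_max_right t (-affineForm β (y, 1) / affineForm β (u, 0)))
      rw [hline]; linarith
    have := hconv (hmem y hyP ⟨α, hα, hαy⟩) hend (a := 1 - t / s) (b := t / s)
      (by rw [sub_nonneg]; exact (div_le_one hs).2 hts) (by positivity) (by ring)
    change y + t • u ∈ cutHull L P
    convert this using 1
    rw [smul_add, smul_smul, div_mul_cancel₀ _ hs.ne']
    module

/-- `cutHull` is monotone in the positions of the points where the segments and rays spanned by
the generators of `P` leave the interior of the cutting set. -/
theorem cutHull_subset {N₁ N₂ : ℕ} {L₁ L₂ P : Set (Fin d → ℝ)} {F₁ F₂ : Finset ((Fin d → ℤ) × ℤ)}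
    (h₁ : IsFacetSystem F₁ N₁ L₁) (h₂ : IsFacetSystem F₂ N₂ L₂) {G : Set ((Fin d → ℤ) × ℤ)}
    (hG : ∀ z ∈ PointedCone.hull ℝ (intVec '' G), 0 ≤ z.2)
    (hP : ∀ x, x ∈ P ↔ (x, (1 : ℝ)) ∈ PointedCone.hull ℝ (intVec '' G))
    (hout : ∀ g ∈ G, (∃ α ∈ F₁, 0 ≤ intForm α g) → ∃ α ∈ F₂, 0 ≤ intForm α g)
    (hslope : ∀ g ∈ G, ∀ k ∈ G, 0 < g.2 → (∀ α ∈ F₁, intForm α g < 0) →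
      (∀ α ∈ F₂, intForm α g < 0) → ∀ α ∈ F₁, 0 < intForm α k →
      ∃ β ∈ F₂, intForm α k * -intForm β g ≤ intForm β k * -intForm α g) :
    cutHull L₁ P ⊆ cutHull L₂ P := by
  have hconv : Convex ℝ (cutHull L₂ P) := convex_convexHull ℝ _
  set H := PointedCone.hull ℝ (intVec '' G) with hH
  set K := homogenization (cutHull L₂ P) hconv with hK
  have hgenH : ∀ g ∈ G, intVec g ∈ H := fun g hg => Submodule.subset_span ⟨g, hg, rfl⟩
  have hgen : ∀ g ∈ G, g.2 = 0 ∨ 0 < g.2 := by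
    intro g hg
    have : (0 : ℝ) ≤ g.2 := hG _ (hgenH g hg)
    have : 0 ≤ g.2 := by exact_mod_cast this
    omega
  have hray : ∀ g ∈ G, g.2 = 0 → intVec g ∈ K := by
    intro g hg h0
    have h0' : (intVec g).2 = 0 := by simp [intVec, h0]
    refine mem_homogenization.2 (Or.inr ⟨h0', h₂.recCone_subset P fun x hx t ht => ?_⟩)
    rw [hP] at hx ⊢
    have := H.add_mem hx (PointedCone.smul_mem H ht (hgenH g hg))
    convert this using 1
    ext <;> simp [h0']
  have hpoint : ∀ z ∈ H, 0 < z.2 → ∀ β ∈ F₂, 0 ≤ affineForm β z → z ∈ K := by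
    intro z hz hz2 β hβ hβz
    have hscale : (z.2⁻¹ • z.1, (1 : ℝ)) = z.2⁻¹ • z := by
      ext <;> simp [hz2.ne']
    refine mem_homogenization.2 (Or.inl ⟨hz2, subset_convexHull ℝ _ ⟨?_, ?_⟩⟩)
    · rw [hP, hscale]
      exact PointedCone.smul_mem H (inv_nonneg.2 hz2.le) hz
    · refine h₂.notMem_interior_iff.2 ⟨β, hβ, ?_⟩
      rw [hscale, map_smul, smul_eq_mul]
      positivity
  have houtK : ∀ g ∈ G, 0 < g.2 → ∀ β ∈ F₂, 0 ≤ intForm β g → intVec g ∈ K := by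
    intro g hg hg2 β hβ hβg
    refine hpoint _ (hgenH g hg) (by simpa [intVec] using hg2) β hβ ?_
    rw [affineForm_intVec]; exact_mod_cast hβg
  have hF₁K : ∀ g ∈ G, ∀ α ∈ F₁, 0 ≤ intForm α g → intVec g ∈ K := by
    intro g hg α hα hαg
    rcases hgen g hg with h0 | hg2
    · exact hray g hg h0
    · obtain ⟨β, hβ, hβg⟩ := hout g hg ⟨α, hα, hαg⟩
      exact houtK g hg hg2 β hβ hβg
  refine convexHull_min ?_ hconv
  rintro x ⟨hxP, hxL⟩
  obtain ⟨α, hα, hαx⟩ := h₁.notMem_interior_iff.1 hxL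
  rw [← mk_one_mem_homogenization (hC := hconv)]
  -- It remains to put into `K` the generators with `α ≥ 0` and the crossing points on `α = 0`.
  refine PointedCone.mem_of_mem_hull_of_nonneg (intVec '' G) (affineForm α) K ?_ ?_
    ((hP x).1 hxP) hαx
  · rintro _ ⟨g, hg, rfl⟩ hαg
    rw [affineForm_intVec] at hαg
    exact hF₁K g hg α hα (by exact_mod_cast hαg)
  · rintro _ ⟨g, hg, rfl⟩ _ ⟨k, hk, rfl⟩ hαg hαk
    have hkK : intVec k ∈ K := by
      rw [affineForm_intVec] at hαk
      exact hF₁K k hk α hα (by exact_mod_cast hαk.le)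
    have hcomb : ∀ C : PointedCone ℝ ((Fin d → ℝ) × ℝ), intVec g ∈ C → intVec k ∈ C →
        affineForm α (intVec k) • intVec g - affineForm α (intVec g) • intVec k ∈ C := by
      intro C hgC hkC
      rw [sub_eq_add_neg, ← neg_smul]
      exact C.add_mem (PointedCone.smul_mem C hαk.le hgC)
        (PointedCone.smul_mem C (neg_nonneg.2 hαg.le) hkC)
    -- If `g` is not in `K`, it has positive height and lies inside both sets, so `hslope` applies:
    -- its inequality says that `β` is nonnegative at the crossing point.
    by_cases hgK : intVec g ∈ K
    · exact hcomb K hgK hkK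
    · have hg2 : 0 < g.2 := (hgen g hg).resolve_left fun h0 => hgK (hray g hg h0)
      have hin₁ : ∀ β ∈ F₁, intForm β g < 0 := fun β hβ =>
        not_le.1 fun h => hgK (hF₁K g hg β hβ h)
      have hin₂ : ∀ β ∈ F₂, intForm β g < 0 := fun β hβ =>
        not_le.1 fun h => hgK (houtK g hg hg2 β hβ h)
      have hαk' : 0 < intForm α k := by
        rw [affineForm_intVec] at hαk; exact_mod_cast hαk
      obtain ⟨β, hβ, hle⟩ := hslope g hg k hk hg2 hin₁ hin₂ α hα hαk'
      refine hpoint _ (hcomb H (hgenH g hg) (hgenH k hk)) ?_ β hβ ?_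
      · have hg2' : (0 : ℝ) < (intVec g).2 := by simpa [intVec] using hg2
        have hk2 := hG _ (hgenH k hk)
        rw [Prod.snd_sub, Prod.smul_snd, Prod.smul_snd, smul_eq_mul, smul_eq_mul]
        nlinarith [mul_pos hαk hg2', mul_nonneg (neg_nonneg.2 hαg.le) hk2]
      · rw [map_sub, map_smul, map_smul, smul_eq_mul, smul_eq_mul]
        simp only [affineForm_intVec]
        have : (intForm α k : ℝ) * -intForm β g ≤ intForm β k * -intForm α g := by
          exact_mod_cast hle
        linarith

/-- The values at `g` of `α` and its opposite are both negative and sum to at least `-N * g.2`. -/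
theorem neg_intForm_le (h : IsFacetSystem F N L) {g : (Fin d → ℤ) × ℤ} (hg : 0 < g.2)
    (hin : ∀ α ∈ F, intForm α g < 0) {α : (Fin d → ℤ) × ℤ} (hα : α ∈ F) :
    -intForm α g ≤ N * g.2 := by
  obtain ⟨b, hb, hle⟩ := h.exists_opposite α hα
  have h1 := hin _ hb
  simp only [intForm, neg_dotProduct] at h1 ⊢
  nlinarith [mul_le_mul_of_nonneg_right hle hg.le]

end IsFacetSystem

/-! ### Scores in the natural numbers and Dickson's lemma -/

open Classical in
/-- Indicator of the generators that are not in the interior of the set described by `F`. -/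
noncomputable def outsideScore {d : ℕ} (F : Finset ((Fin d → ℤ) × ℤ)) (g : (Fin d → ℤ) × ℤ) : ℕ :=
  if ∃ α ∈ F, 0 ≤ intForm α g then 1 else 0

/-- The reciprocal of the smallest `t ≥ 0` for which `g + t • k` leaves the interior of the set
described by `F`, multiplied by a common denominator that depends only on `g` and `N`. -/
def slopeScore {d : ℕ} (N : ℕ) (F : Finset ((Fin d → ℤ) × ℤ)) (g k : (Fin d → ℤ) × ℤ) : ℕ :=
  F.sup fun α => (N * g.2.toNat).factorial * (intForm α k).toNat / (-intForm α g).toNat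

/-- With `g` inside both sets, every `-α(g)` is positive and divides the factorial, so the
natural-number quotients are exact and comparing them compares fractions. -/
theorem exists_le_of_slopeScore_le {d N : ℕ} {L₁ L₂ : Set (Fin d → ℝ)}
    {F₁ F₂ : Finset ((Fin d → ℤ) × ℤ)} (h₁ : IsFacetSystem F₁ N L₁) (h₂ : IsFacetSystem F₂ N L₂)
    {g k : (Fin d → ℤ) × ℤ} (hg : 0 < g.2) (hin₁ : ∀ α ∈ F₁, intForm α g < 0)
    (hin₂ : ∀ α ∈ F₂, intForm α g < 0) (hle : slopeScore N F₁ g k ≤ slopeScore N F₂ g k)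
    {α : (Fin d → ℤ) × ℤ} (hα : α ∈ F₁) (hαk : 0 < intForm α k) :
    ∃ β ∈ F₂, intForm α k * -intForm β g ≤ intForm β k * -intForm α g := by
  set B := (N * g.2.toNat).factorial with hB
  have hBpos : 0 < B := Nat.factorial_pos _
  have hbound : ∀ {F : Finset ((Fin d → ℤ) × ℤ)} {L : Set (Fin d → ℝ)}, IsFacetSystem F N L →
      (∀ α ∈ F, intForm α g < 0) → ∀ α ∈ F,
        0 < (-intForm α g).toNat ∧ (-intForm α g).toNat ∣ B := by
    intro F L h hin α hα
    have h1 := h.neg_intForm_le hg hin hα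
    have h2 := hin α hα
    have hpos : 0 < (-intForm α g).toNat := by omega
    refine ⟨hpos, Nat.dvd_factorial hpos ?_⟩
    zify
    rw [Int.toNat_of_nonneg (by omega), Int.toNat_of_nonneg hg.le]
    exact h1
  obtain ⟨hpα, hdα⟩ := hbound h₁ hin₁ α hα
  have hle' : B * (intForm α k).toNat / (-intForm α g).toNat ≤ slopeScore N F₂ g k :=
    (Finset.le_sup (f := fun α => B * (intForm α k).toNat / (-intForm α g).toNat) hα).trans hle
  have hqpos : 0 < B * (intForm α k).toNat / (-intForm α g).toNat :=
    Nat.div_pos ((Nat.le_of_dvd hBpos hdα).trans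
      (Nat.le_mul_of_pos_right _ (by omega))) hpα
  -- Positivity excludes the value `0` of an empty supremum, so some `β` attains the bound.
  obtain ⟨β, hβ, hαβ⟩ := (Finset.le_sup_iff hqpos).1 hle'
  refine ⟨β, hβ, ?_⟩
  obtain ⟨hpβ, hdβ⟩ := hbound h₂ hin₂ β hβ
  have key : B * ((intForm α k).toNat * (-intForm β g).toNat) ≤
      B * ((intForm β k).toNat * (-intForm α g).toNat) := by
    have e₁ := Nat.div_mul_cancel (hdα.mul_right (intForm α k).toNat)
    have e₂ := Nat.div_mul_cancel (hdβ.mul_right (intForm β k).toNat)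
    rw [← mul_assoc, ← mul_assoc, ← e₁, ← e₂, mul_right_comm (_ / (-intForm β g).toNat)]
    gcongr
  have key := Nat.le_of_mul_le_mul_left key hBpos
  have hβk : 0 < intForm β k := by
    by_contra hneg
    have h0 : (intForm β k).toNat = 0 := by omega
    rw [h0, zero_mul, Nat.le_zero, mul_eq_zero] at key
    omega
  have hneg₁ := hin₁ α hα
  have hneg₂ := hin₂ β hβ
  zify at key
  rwa [Int.toNat_of_nonneg hαk.le, Int.toNat_of_nonneg hβk.le, Int.toNat_of_nonneg (by omega),
    Int.toNat_of_nonneg (by omega)] at key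

/-- The minimal values form an antichain, hence a finite set, and every value lies above one of
them; one preimage of each suffices. -/
theorem exists_finite_forall_exists_le {ι β : Type*} [Nonempty ι] [PartialOrder β]
    [WellQuasiOrderedLE β] (s : Set ι) (f : ι → β) :
    ∃ t ⊆ s, t.Finite ∧ ∀ x ∈ s, ∃ y ∈ t, f y ≤ f x := by
  set M := {b | Minimal (· ∈ f '' s) b} with hM
  have hfin : M.Finite := WellQuasiOrderedLE.finite_of_isAntichain (setOfPred_minimal_antichain _)
  have hpre : ∀ b ∈ M, ∃ x ∈ s, f x = b := fun b hb => hb.prop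
  choose! r hr hfr using hpre
  refine ⟨r '' M, Set.image_subset_iff.2 hr, hfin.image r, fun x hx => ?_⟩
  obtain ⟨b, hb, hmin⟩ := (Set.isPWO_of_wellQuasiOrderedLE (f '' s)).exists_le_minimal
    (Set.mem_image_of_mem f hx)
  exact ⟨r b, ⟨b, hmin, rfl⟩, (hfr b hmin).trans_le hb⟩

theorem exists_hasFacetWidthRep_of_maxFacetWidth_le {d N : ℕ} {L : Set (Fin d → ℝ)}
    (h : maxFacetWidth L ≤ N) : ∃ m ≤ N, HasFacetWidthRep L m := by
  unfold maxFacetWidth at h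
  split_ifs at h
  -- The strict bound `N + 1` extracts a witness from the infimum, which would be `⊤` if no
  -- representation existed.
  · have hlt := h.trans_lt (ENat.natCast_lt_succ (n := N))
    simp only [iInf_lt_iff] at hlt
    obtain ⟨m, ⟨-, hm⟩, hlt⟩ := hlt
    exact ⟨m, by exact_mod_cast Order.le_of_lt_add_one hlt, hm⟩
  · exact absurd h (by simp)

theorem theorem1 (d : ℕ) (P : Set (Fin d → ℝ)) (hP : IsRationalPolyhedron P)
    (𝓛 : Set (Set (Fin d → ℝ)))
    (h𝓛 : ∀ L ∈ 𝓛, IsRationalPolyhedron L ∧ IsFullDimensional L)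
    (hm : familyMaxFacetWidth 𝓛 < ⊤) :
    ∃ 𝓛' : Set (Set (Fin d → ℝ)), 𝓛' ⊆ 𝓛 ∧ 𝓛'.Finite ∧
      ∀ L ∈ 𝓛, ∃ L' ∈ 𝓛', cutHull L' P ⊆ cutHull L P := by
  obtain ⟨N, hN⟩ := ENat.ne_top_iff_exists.1 hm.ne
  have hF : ∀ L ∈ 𝓛, ∃ F, IsFacetSystem F N L := by
    intro L hL
    obtain ⟨m, hmN, hrep⟩ := exists_hasFacetWidthRep_of_maxFacetWidth_le (L := L) (N := N)
      (hN ▸ le_iSup₂ (f := fun L (_ : L ∈ 𝓛) => maxFacetWidth L) L hL)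
    exact hrep.exists_isFacetSystem hmN
  choose! F hF using hF
  obtain ⟨G, hGfin, hG, hPG⟩ := hP.exists_generators
  have : Finite G := hGfin
  -- A smaller score means fewer generators outside and later exits, hence a smaller hull.
  let score : Set (Fin d → ℝ) → (G → ℕ) × (G × G → ℕ) := fun L =>
    (fun g => outsideScore (F L) g, fun q => slopeScore N (F L) q.1 q.2)
  obtain ⟨𝓛', hsub, hfin, hle⟩ := exists_finite_forall_exists_le 𝓛 score
  refine ⟨𝓛', hsub, hfin, fun L hL => ?_⟩
  obtain ⟨L', hL', hscore⟩ := hle L hL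
  refine ⟨L', hL', (hF L' (hsub hL')).cutHull_subset (hF L hL) hG hPG (fun g hg hex => ?_)
    fun g hg k hk hg2 hin₁ hin₂ α hα hαk => ?_⟩
  · have h1 : outsideScore (F L') g ≤ outsideScore (F L) g := hscore.1 ⟨g, hg⟩
    by_contra hnot
    rw [outsideScore, outsideScore, if_pos hex, if_neg hnot] at h1
    omega
  · exact exists_le_of_slopeScore_le (hF L' (hsub hL')) (hF L hL) hg2 hin₁ hin₂
      (hscore.2 (⟨g, hg⟩, ⟨k, hk⟩)) hα hαk
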